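/- Let $A_{5,3}$ be the real nilpotent Lie algebra with basis $e_1,\dots,e_5$ whose only non-zero brackets, up to skew-symmetry, are $[e_1,e_2]=e_3$, $[e_1,e_3]=e_4$, $[e_2,e_3]=e_5$, and let $G$ be a Lie group whose Lie algebra $\mathfrak g$ is isomorphic to $A_{5,3}$. For a left-invariant Riemannian metric $g$ on $G$, a basis $\mathcal B_7$ for $g$ with structure constants $(\alpha,\beta,\gamma,\delta,\varepsilon)$ is a basis $v=(v_1,\dots,v_5)$ of $\mathfrak g$ that is orthonormal for $\eta g$ for some $\eta>0$ and whose only possibly non-zero brackets are $$[v_1,v_2]=\alpha v_3+\beta v_4,\qquad [v_1,v_3]=\gamma v_4+\delta v_5,\qquad [v_2,v_3]=\varepsilon v_5,\qquad \alpha,\gamma,\varepsilon>0,\ \beta,\delta\in\mathbb R .$$ For signs $\sigma,\tau\in\{1,-1\}$ say that a real $5\times5$ matrix $M$ satisfies the conditions $\mathcal C_{\sigma,\tau}$ if $$M=\begin{pmatrix}a&f&0&0&0\\ f&b&l&0&0\\ 0&l&c&h&0\\ 0&0&h&d&i\\ 0&0&0&i&e\end{pmatrix}$$ and 1. $A:=-(b+c+d+e)>0$;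 2. $B:=b+c+d+2e\ge 0$; 3. $C:=-(a+b+2c+2d+3e)>0$; 4. $D:=a+b+2c+3d+3e\ge 0$; 5. $E:=-(a+b+c+2d+2e)>0$; 6. $f+\sigma\sqrt{AB}=0$; 7. $l+\tau\sqrt{CD}=0$; 8. $-h+\tau\sqrt{DE}=0$; 9. $-i+\sigma\sqrt{BC}=0$. Then the following hold. (a) Every left-invariant Riemannian metric $g$ on $G$ has a basis $\mathcal B_7$. If $T$ is a left-invariant symmetric $(0,2)$-tensor field on $G$, $t\ne0$ and $\mathrm{Ric}(g)=t^2T$, then the matrix of $T$ in every basis $\mathcal B_7$ for $g$ satisfies $\mathcal C_{\sigma,\tau}$ for some signs $\sigma,\tau$. (b) Let $M$ be a real $5\times 5$ matrix. There are a left-invariant Riemannian metric $g$, a real $t\neq0$, a basis $\mathcal B_7$ for $g$, and a left-invariant symmetric $(0,2)$-tensor field $T$ with matrix $M$ in this basis such that $\mathrm{Ric}(g)=t^2T$, if and only if $M$ satisfies $\mathcal C_{\sigma,\tau}$ for some signs $\sigma,\tau$. In that case such $g$, basis and $T$ exist for every prescribed $t\ne0$. (c) For a given left-invariant symmetric $(0,2)$-tensor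 field $T$ on $G$ there is a pair $(g,t)$, with $g$ a left-invariant Riemannian metric and $t\ne0$ real, such that $\mathrm{Ric}(g)=t^2T$, if and only if there are $t\ne0$, signs $\sigma,\tau$, and a basis $v$ of $\mathfrak g$ such that the matrix of $T$ in $v$ satisfies $\mathcal C_{\sigma,\tau}$ and the only possibly non-zero brackets of $v$ are the ones displayed above with $$\alpha=|t|\sqrt{2E},\quad \beta=\tau|t|\sqrt{2D},\quad \gamma=|t|\sqrt{2C},\quad \delta=\sigma|t|\sqrt{2B},\quad \varepsilon=|t|\sqrt{2A}.$$ -/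

import Mathlib

open scoped Manifold ContDiff

noncomputable section

namespace PrescribedRicci

/-! ### Inner products on a Lie algebra and their Ricci curvature -/

section LieAlgebra

variable {L : Type*} [LieRing L] [LieAlgebra ℝ L]

/-- An inner product (positive definite symmetric bilinear form) on a real vector space. -/
structure InnerProd (V : Type*) [AddCommGroup V] [Module ℝ V] where
  form : LinearMap.BilinForm ℝ V
  symm : ∀ u v, form u v = form v u
  pos : ∀ u, u ≠ 0 → 0 < form u u

theorem InnerProd.nondegenerate {V : Type*} [AddCommGroup V] [Module ℝ V] (g : InnerProd V) :
    g.form.Nondegenerate := by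
  refine ⟨fun u hu => ?_, fun u hu => ?_⟩ <;>
  · by_contra h
    exact (g.pos u h).ne' (hu u)

/-- The linear form `z ↦ (⟨[x,y],z⟩ - ⟨[y,z],x⟩ + ⟨[z,x],y⟩) / 2`: the right-hand side of the
Koszul formula for left-invariant vector fields `x, y, z`, whose mutual scalar products are
constant functions. -/
def koszul (g : InnerProd L) (x y : L) : Module.Dual ℝ L where
  toFun z := (g.form ⁅x, y⁆ z - g.form ⁅y, z⁆ x + g.form ⁅z, x⁆ y) / 2
  map_add' a b := by simp; ring
  map_smul' c a := by simp; ring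

variable [FiniteDimensional ℝ L]

/-- The Levi-Civita connection `(x, y) ↦ ∇_x y` of the left-invariant metric with value `g` at the
identity, on left-invariant vector fields: `∇_x y` is the vector that represents the Koszul form,
`⟨∇_x y, z⟩ = (⟨[x,y],z⟩ - ⟨[y,z],x⟩ + ⟨[z,x],y⟩) / 2` for all `z`. -/
def nabla (g : InnerProd L) : L →ₗ[ℝ] L →ₗ[ℝ] L :=
  LinearMap.mk₂ ℝ (fun x y => (g.form.toDual g.nondegenerate).symm (koszul g x y))
    (fun x x' y => by
      rw [← map_add]; congr 1; ext z; simp [koszul]; ring)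
    (fun c x y => by
      rw [← map_smul]; congr 1; ext z; simp [koszul]; ring)
    (fun x y y' => by
      rw [← map_add]; congr 1; ext z; simp [koszul]; ring)
    (fun c x y => by
      rw [← map_smul]; congr 1; ext z; simp [koszul]; ring)

theorem nabla_spec (g : InnerProd L) (x y z : L) :
    g.form (nabla g x y) z = (g.form ⁅x, y⁆ z - g.form ⁅y, z⁆ x + g.form ⁅z, x⁆ y) / 2 := by
  simp only [nabla, LinearMap.mk₂_apply]
  rw [LinearMap.BilinForm.apply_toDual_symm_apply]
  rfl

/-- For fixed `y, z`, the endomorphism `x ↦ R(x,y)z = ∇_x ∇_y z - ∇_y ∇_x z - ∇_[x,y] z`. -/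
def curvatureEnd (g : InnerProd L) (y z : L) : L →ₗ[ℝ] L where
  toFun x := nabla g x (nabla g y z) - nabla g y (nabla g x z) - nabla g ⁅x, y⁆ z
  map_add' a b := by simp; abel
  map_smul' c a := by simp [smul_sub]

/-- The Ricci curvature `ric(y,z) = tr (x ↦ R(x,y)z)`. -/
def ricci (g : InnerProd L) (y z : L) : ℝ := LinearMap.trace ℝ L (curvatureEnd g y z)

end LieAlgebra

/-! ### Bases adapted to the Lie algebra `A_{5,3}` -/

section Bases

variable {L : Type*} [LieRing L] [LieAlgebra ℝ L]

/-- Up to skew-symmetry, the only possibly non-zero brackets of the basis `v = (v₁, …, v₅)` are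
`[v₁,v₂] = α v₃ + β v₄`, `[v₁,v₃] = γ v₄ + δ v₅`, `[v₂,v₃] = ε v₅`.
(The vector `vᵢ` is `v (i - 1)`.) -/
structure HasBrackets (v : Module.Basis (Fin 5) ℝ L) (α β γ δ ε : ℝ) : Prop where
  b12 : ⁅v 0, v 1⁆ = α • v 2 + β • v 3
  b13 : ⁅v 0, v 2⁆ = γ • v 3 + δ • v 4
  b23 : ⁅v 1, v 2⁆ = ε • v 4
  b14 : ⁅v 0, v 3⁆ = 0
  b15 : ⁅v 0, v 4⁆ = 0
  b24 : ⁅v 1, v 3⁆ = 0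
  b25 : ⁅v 1, v 4⁆ = 0
  b34 : ⁅v 2, v 3⁆ = 0
  b35 : ⁅v 2, v 4⁆ = 0
  b45 : ⁅v 3, v 4⁆ = 0

variable (L) in
/-- `L` is (isomorphic to) the Lie algebra `A_{5,3}`: it has a basis `e₁, …, e₅` whose non-zero
brackets are `[e₁,e₂] = e₃`, `[e₁,e₃] = e₄`, `[e₂,e₃] = e₅`. -/
def IsA53 : Prop := ∃ e : Module.Basis (Fin 5) ℝ L, HasBrackets e 1 0 1 0 1

/-- `v` is a basis `𝓑₇` for the inner product `g`, with structure constants `α, β, γ, δ, ε`: it is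
orthonormal with respect to a positive multiple `η g`, and has brackets as above with
`α, γ, ε > 0`. -/
structure IsB7 (g : InnerProd L) (v : Module.Basis (Fin 5) ℝ L) (α β γ δ ε : ℝ) : Prop where
  α_pos : 0 < α
  γ_pos : 0 < γ
  ε_pos : 0 < ε
  brackets : HasBrackets v α β γ δ ε
  orthonormal : ∃ η : ℝ, 0 < η ∧ ∀ i j, η * g.form (v i) (v j) = if i = j then 1 else 0

end Bases

/-! ### The conditions on the matrix

The diagonal entries are `a, b, c, d, e`, the off-diagonal ones are `f, l, h, i`. -/

section Conditions

variable (M : Matrix (Fin 5) (Fin 5) ℝ)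

/-- `A = -(b + c + d + e)` -/
def coefA : ℝ := -(M 1 1 + M 2 2 + M 3 3 + M 4 4)

/-- `B = b + c + d + 2e` -/
def coefB : ℝ := M 1 1 + M 2 2 + M 3 3 + 2 * M 4 4

/-- `C = -(a + b + 2c + 2d + 3e)` -/
def coefC : ℝ := -(M 0 0 + M 1 1 + 2 * M 2 2 + 2 * M 3 3 + 3 * M 4 4)

/-- `D = a + b + 2c + 3d + 3e` -/
def coefD : ℝ := M 0 0 + M 1 1 + 2 * M 2 2 + 3 * M 3 3 + 3 * M 4 4

/-- `E = -(a + b + c + 2d + 2e)` -/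
def coefE : ℝ := -(M 0 0 + M 1 1 + M 2 2 + 2 * M 3 3 + 2 * M 4 4)

/-- `M` is symmetric and tridiagonal, and its entries satisfy the conditions (1)–(9), where `σ` is
the sign `±` in the conditions on `f` and `i`, and `τ` the one in the conditions on `l` and `h`. -/
structure Conditions (σ τ : ℝ) : Prop where
  σ_sign : σ = 1 ∨ σ = -1
  τ_sign : τ = 1 ∨ τ = -1
  form : ∃ a b c d e f l h i : ℝ, M =
    !![a, f, 0, 0, 0;
       f, b, l, 0, 0;
       0, l, c, h, 0;
       0, 0, h, d, i;
       0, 0, 0, i, e]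
  A_pos : 0 < coefA M
  B_nonneg : 0 ≤ coefB M
  C_pos : 0 < coefC M
  D_nonneg : 0 ≤ coefD M
  E_pos : 0 < coefE M
  f_eq : M 0 1 + σ * √(coefA M * coefB M) = 0
  l_eq : M 1 2 + τ * √(coefC M * coefD M) = 0
  h_eq : -M 2 3 + τ * √(coefD M * coefE M) = 0
  i_eq : -M 3 4 + σ * √(coefB M * coefC M) = 0

end Conditions

/-! ### Left-invariant tensor fields on a Lie group -/

section LieGroup

/-- The standard model of a 5-dimensional real manifold. -/
abbrev R5 : Type := EuclideanSpace ℝ (Fin 5)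

variable (G : Type*) [TopologicalSpace G] [ChartedSpace R5 G] [Group G]

/-- The Lie algebra of `G`: the tangent space at the identity, with the bracket of left-invariant
vector fields. -/
abbrev LieAlg : Type := GroupLieAlgebra 𝓘(ℝ, R5) G

/-- The tangent space of `G` at `x`. -/
abbrev Tan {G : Type*} [TopologicalSpace G] [ChartedSpace R5 G] (x : G) : Type :=
  TangentSpace 𝓘(ℝ, R5) x

instance instFiniteDimensionalTan {G : Type*} [TopologicalSpace G] [ChartedSpace R5 G] (x : G) :
    FiniteDimensional ℝ (Tan x) :=
  inferInstanceAs (FiniteDimensional ℝ R5)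

/-- A left-invariant symmetric `(0,2)`-tensor field on `G`. -/
structure LeftInvSymTensor where
  val : ∀ x : G, LinearMap.BilinForm ℝ (Tan x)
  symm : ∀ (x : G) (u v : Tan x), val x u v = val x v u
  leftInv : ∀ (x y : G) (u v : Tan y),
    val (x * y) (mfderiv 𝓘(ℝ, R5) 𝓘(ℝ, R5) (fun z : G => x * z) y u)
      (mfderiv 𝓘(ℝ, R5) 𝓘(ℝ, R5) (fun z : G => x * z) y v) = val y u v

/-- A left-invariant Riemannian metric on `G` (its smoothness follows from left-invariance). -/
structure LeftInvMetric extends LeftInvSymTensor G where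
  pos : ∀ (x : G) (u : Tan x), u ≠ 0 → 0 < val x u u

variable {G}

/-- The inner product on the Lie algebra given by a left-invariant metric. -/
def LeftInvMetric.inner (g : LeftInvMetric G) : InnerProd (LieAlg G) where
  form := g.val 1
  symm := g.symm 1
  pos := g.pos 1

/-- The differential at `x` of the left translation by `x⁻¹`, from `T_x G` to the Lie algebra. -/
def toIdentity (x : G) (u : Tan x) : LieAlg G :=
  mfderiv 𝓘(ℝ, R5) 𝓘(ℝ, R5) (fun z : G => x⁻¹ * z) x u

variable [LieGroup 𝓘(ℝ, R5) (minSmoothness ℝ 3) G]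

/-- The Ricci tensor field of a left-invariant metric: it is left-invariant (left translations are
isometries), and on left-invariant vector fields it is `ricci`. -/
def LeftInvMetric.Ric (g : LeftInvMetric G) (x : G) (u v : Tan x) : ℝ :=
  ricci g.inner (toIdentity x u) (toIdentity x v)

/-- The equation `Ric(g) = t² T` between tensor fields on `G`. -/
def RicciEq (g : LeftInvMetric G) (t : ℝ) (T : LeftInvSymTensor G) : Prop :=
  ∀ (x : G) (u v : Tan x), g.Ric x u v = t ^ 2 * T.val x u v

/-- The matrix of the left-invariant tensor field `T` in a basis of the Lie algebra. -/
def LeftInvSymTensor.matrix (T : LeftInvSymTensor G)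
    (v : Module.Basis (Fin 5) ℝ (LieAlg G)) : Matrix (Fin 5) (Fin 5) ℝ :=
  Matrix.of fun i j => T.val 1 (v i) (v j)

end LieGroup

end PrescribedRicci

end

open PrescribedRicci

open scoped Manifold ContDiff
open PrescribedRicci

/-! Rescaling a metric does not change its Ricci tensor, so in a basis `𝓑₇` the Ricci matrix depends
only on the structure constants. It is the tridiagonal `ricciTable`. Its five diagonal entries are
linear in the squares of the constants, and this linear map is invertible: up to the factor 2t², the
combinations A, B, C, D, E of the diagonal of T are ε², δ², γ², β², α². The four off-diagonal
entries are products δε, βγ, αβ, γδ up to a factor ±1/2; since α, γ, ε > 0, the only remaining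
freedom is the sign σ of δ and the sign τ of β. This gives the conditions
(`conditions_of_ricciTable`).

Conversely, the conditions allow the constants to be defined by these square roots, for any t ≠ 0
(`ricciTable_of_conditions`). The Lie algebra has a basis with any such constants
(`exists_hasBrackets`), and declaring it orthonormal gives the metric.

That every metric has a basis `𝓑₇` (`exists_isB7`) follows from Gram–Schmidt along the flag of spans
of the last basis vectors, a rotation of the centre, a rotation of the first two vectors, and sign
changes. -/

section RicciInBasis

/-! ### Ricci curvature in terms of structure constants -/

variable {L : Type*} [LieRing L] [LieAlgebra ℝ L]

/-- The structure constants `⟨[vᵢ, vⱼ], vₖ⟩` of a basis as in `HasBrackets`. -/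
noncomputable def structConst (α β γ δ ε : ℝ) : Fin 5 → Fin 5 → Fin 5 → ℝ :=
  ![![0, ![0, 0, α, β, 0], ![0, 0, 0, γ, δ], 0, 0],
    ![![0, 0, -α, -β, 0], 0, ![0, 0, 0, 0, ε], 0, 0],
    ![![0, 0, 0, -γ, -δ], ![0, 0, 0, 0, -ε], 0, 0, 0],
    0, 0]

theorem PrescribedRicci.HasBrackets.lie_eq_sum {v : Module.Basis (Fin 5) ℝ L} {α β γ δ ε : ℝ}
    (h : HasBrackets v α β γ δ ε) (i j : Fin 5) :
    ⁅v i, v j⁆ = ∑ k, structConst α β γ δ ε i j k • v k := by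
  obtain ⟨h1, h2, h3, h4, h5, h6, h7, h8, h9, h10⟩ := h
  have skew : ∀ {x y z : L}, ⁅x, y⁆ = z → ⁅y, x⁆ = -z := by
    rintro x y z rfl; exact (lie_skew y x).symm
  fin_cases i <;> fin_cases j <;>
    simp [structConst, Fin.sum_univ_five, h1, h2, h3, h4, h5, h6, h7, h8, h9, h10,
      skew h1, skew h2, skew h3, skew h4, skew h5, skew h6, skew h7, skew h8, skew h9, skew h10] <;>
    abel

/-- The Christoffel symbols of an orthonormal basis with structure constants `c`. -/
noncomputable def christoffel {ι : Type*} (c : ι → ι → ι → ℝ) (i j k : ι) : ℝ :=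
  (c i j k - c j k i + c k i j) / 2

variable {ι : Type*} [Fintype ι] [DecidableEq ι]

/-- Expansion in a basis that is orthonormal up to scale. -/
theorem PrescribedRicci.InnerProd.repr_eq {V : Type*} [AddCommGroup V] [Module ℝ V]
    (g : InnerProd V) (v : Module.Basis ι ℝ V) {η : ℝ}
    (hv : ∀ i j, η * g.form (v i) (v j) = if i = j then 1 else 0) (x : V) (k : ι) :
    v.repr x k = η * g.form x (v k) := by
  conv_rhs => rw [← v.sum_repr x]
  simp only [map_sum, map_smul, LinearMap.sum_apply, LinearMap.smul_apply, smul_eq_mul,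
    Finset.mul_sum]
  simp_rw [mul_left_comm η, hv]
  simp

variable [FiniteDimensional ℝ L]

/-- Multiplying the Koszul formula by `η` turns each scalar product into a structure constant and
the left side into a coordinate, so the scale drops out. -/
theorem nabla_basis (g : InnerProd L) (v : Module.Basis ι ℝ L) {η : ℝ}
    (hv : ∀ i j, η * g.form (v i) (v j) = if i = j then 1 else 0) {c : ι → ι → ι → ℝ}
    (hc : ∀ i j, ⁅v i, v j⁆ = ∑ k, c i j k • v k) (i j : ι) :
    nabla g (v i) (v j) = ∑ k, christoffel c i j k • v k := by
  have key : ∀ i j k, η * g.form ⁅v i, v j⁆ (v k) = c i j k := by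
    intro i j k
    rw [← g.repr_eq v hv, hc]
    simp [Finsupp.single_apply]
  rw [← v.sum_repr (nabla g (v i) (v j))]
  refine Finset.sum_congr rfl fun k _ => ?_
  rw [g.repr_eq v hv, nabla_spec, christoffel, ← key i j k, ← key j k i, ← key k i j]
  congr 1
  ring

/-- The Ricci curvature in an orthonormal basis with structure constants `c`. -/
noncomputable def ricciOfConst (c : ι → ι → ι → ℝ) (j l : ι) : ℝ :=
  ∑ i, ∑ m, (christoffel c j l m * christoffel c i m i -
    christoffel c i l m * christoffel c j m i - c i j m * christoffel c m l i)

theorem ricci_basis (g : InnerProd L) (v : Module.Basis ι ℝ L) {η : ℝ}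
    (hv : ∀ i j, η * g.form (v i) (v j) = if i = j then 1 else 0) {c : ι → ι → ι → ℝ}
    (hc : ∀ i j, ⁅v i, v j⁆ = ∑ k, c i j k • v k) (j l : ι) :
    ricci g (v j) (v l) = ricciOfConst c j l := by
  have hn := nabla_basis g v hv hc
  rw [ricci, LinearMap.trace_eq_matrix_trace ℝ v, Matrix.trace, ricciOfConst]
  refine Finset.sum_congr rfl fun i _ => ?_
  simp [LinearMap.toMatrix_apply, curvatureEnd, hn, hc, Finsupp.single_apply,
    Finset.sum_sub_distrib]

/-- The matrix of the Ricci tensor in a basis `𝓑₇`. -/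
noncomputable def ricciTable (α β γ δ ε : ℝ) : Matrix (Fin 5) (Fin 5) ℝ :=
  !![-(α ^ 2 + β ^ 2 + γ ^ 2 + δ ^ 2) / 2, -(δ * ε) / 2, 0, 0, 0;
     -(δ * ε) / 2, -(α ^ 2 + β ^ 2 + ε ^ 2) / 2, -(β * γ) / 2, 0, 0;
     0, -(β * γ) / 2, (α ^ 2 - γ ^ 2 - δ ^ 2 - ε ^ 2) / 2, α * β / 2, 0;
     0, 0, α * β / 2, (β ^ 2 + γ ^ 2) / 2, γ * δ / 2;
     0, 0, 0, γ * δ / 2, (δ ^ 2 + ε ^ 2) / 2]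

set_option maxHeartbeats 4000000 in
theorem ricciOfConst_structConst (α β γ δ ε : ℝ) (i j : Fin 5) :
    ricciOfConst (structConst α β γ δ ε) i j = ricciTable α β γ δ ε i j := by
  fin_cases i <;> fin_cases j <;>
    simp [ricciOfConst, ricciTable, christoffel, structConst, Fin.sum_univ_five] <;> ring

theorem PrescribedRicci.IsB7.ricci_eq {g : InnerProd L} {v : Module.Basis (Fin 5) ℝ L}
    {α β γ δ ε : ℝ} (h : IsB7 g v α β γ δ ε) (i j : Fin 5) :
    ricci g (v i) (v j) = ricciTable α β γ δ ε i j := by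
  obtain ⟨η, -, hv⟩ := h.orthonormal
  rw [ricci_basis g v hv h.brackets.lie_eq_sum, ricciOfConst_structConst]

end RicciInBasis

/-! ### From the Ricci matrix to the structure constants and back -/

theorem exists_sign (x : ℝ) : ∃ σ : ℝ, (σ = 1 ∨ σ = -1) ∧ x = σ * |x| := by
  rcases le_total 0 x with h | h
  · exact ⟨1, .inl rfl, by rw [abs_of_nonneg h, one_mul]⟩
  · exact ⟨-1, .inr rfl, by rw [abs_of_nonpos h]; ring⟩

theorem abs_eq_abs_mul_sqrt {t x y : ℝ} (ht : t ≠ 0) (h : x = y ^ 2 / (2 * t ^ 2)) :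
    |y| = |t| * √(2 * x) := by
  have : 2 * x = (|y| / |t|) ^ 2 := by
    rw [h, div_pow, sq_abs, sq_abs]; field_simp
  rw [this, Real.sqrt_sq (by positivity)]
  field_simp

theorem sqrt_mul_eq_of_sq {t x y p q : ℝ} (ht : t ≠ 0) (hx : x = p ^ 2 / (2 * t ^ 2))
    (hy : y = q ^ 2 / (2 * t ^ 2)) : √(x * y) = |p| * |q| / (2 * t ^ 2) := by
  have : x * y = (|p| * |q| / (2 * t ^ 2)) ^ 2 := by
    rw [hx, hy, div_pow, mul_pow, sq_abs, sq_abs]; ring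
  rw [this, Real.sqrt_sq (by positivity)]

/-- The constants are determined up to sign by the matrix of the Ricci tensor. -/
theorem conditions_of_ricciTable {M : Matrix (Fin 5) (Fin 5) ℝ} {t α β γ δ ε : ℝ} (ht : t ≠ 0)
    (hα : 0 < α) (hγ : 0 < γ) (hε : 0 < ε)
    (hM : ∀ i j, ricciTable α β γ δ ε i j = t ^ 2 * M i j) :
    ∃ σ τ : ℝ, Conditions M σ τ ∧
      α = |t| * √(2 * coefE M) ∧ β = τ * (|t| * √(2 * coefD M)) ∧
      γ = |t| * √(2 * coefC M) ∧ δ = σ * (|t| * √(2 * coefB M)) ∧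
      ε = |t| * √(2 * coefA M) := by
  obtain ⟨σ, hσ, hδ⟩ := exists_sign δ
  obtain ⟨τ, hτ, hβ⟩ := exists_sign β
  have hM' : ∀ i j, M i j = ricciTable α β γ δ ε i j / t ^ 2 := fun i j => by
    rw [hM]; field_simp
  -- The five combinations invert the diagonal of the table: each isolates one square.
  have hA : coefA M = ε ^ 2 / (2 * t ^ 2) := by
    simp [coefA, hM', ricciTable]; field_simp; ring
  have hB : coefB M = δ ^ 2 / (2 * t ^ 2) := by
    simp [coefB, hM', ricciTable]; field_simp; ring
  have hC : coefC M = γ ^ 2 / (2 * t ^ 2) := by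
    simp [coefC, hM', ricciTable]; field_simp; ring
  have hD : coefD M = β ^ 2 / (2 * t ^ 2) := by
    simp [coefD, hM', ricciTable]; field_simp; ring
  have hE : coefE M = α ^ 2 / (2 * t ^ 2) := by
    simp [coefE, hM', ricciTable]; field_simp; ring
  refine ⟨σ, τ, ⟨hσ, hτ, ?_, ?_, ?_, ?_, ?_, ?_, ?_, ?_, ?_, ?_⟩, ?_, ?_, ?_, ?_, ?_⟩
  · refine ⟨M 0 0, M 1 1, M 2 2, M 3 3, M 4 4, M 0 1, M 1 2, M 2 3, M 3 4, ?_⟩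
    ext i j
    fin_cases i <;> fin_cases j <;> simp [hM', ricciTable]
  · rw [hA]; positivity
  · rw [hB]; positivity
  · rw [hC]; positivity
  · rw [hD]; positivity
  · rw [hE]; positivity
  · rw [sqrt_mul_eq_of_sq ht hA hB, abs_of_pos hε, hM']
    simp only [ricciTable, Matrix.of_apply, Matrix.cons_val]
    -- Only the first occurrence is rewritten, because `δ` also stands inside `|δ|`.
    nth_rw 1 [hδ]; field_simp; ring
  · rw [sqrt_mul_eq_of_sq ht hC hD, abs_of_pos hγ, hM']
    simp only [ricciTable, Matrix.of_apply, Matrix.cons_val]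
    nth_rw 1 [hβ]; field_simp; ring
  · rw [sqrt_mul_eq_of_sq ht hD hE, abs_of_pos hα, hM']
    simp only [ricciTable, Matrix.of_apply, Matrix.cons_val]
    nth_rw 1 [hβ]; field_simp; ring
  · rw [sqrt_mul_eq_of_sq ht hB hC, abs_of_pos hγ, hM']
    simp only [ricciTable, Matrix.of_apply, Matrix.cons_val]
    nth_rw 1 [hδ]; field_simp; ring
  · rw [← abs_eq_abs_mul_sqrt ht hE, abs_of_pos hα]
  · rw [← abs_eq_abs_mul_sqrt ht hD, ← hβ]
  · rw [← abs_eq_abs_mul_sqrt ht hC, abs_of_pos hγ]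
  · rw [← abs_eq_abs_mul_sqrt ht hB, ← hδ]
  · rw [← abs_eq_abs_mul_sqrt ht hA, abs_of_pos hε]

theorem mul_sqrt_mul_mul_sqrt {t x y : ℝ} (hx : 0 ≤ x) :
    |t| * √(2 * x) * (|t| * √(2 * y)) = 2 * t ^ 2 * √(x * y) := by
  rw [Real.sqrt_mul hx, Real.sqrt_mul (by norm_num), Real.sqrt_mul (by norm_num)]
  have h2 : √2 * √2 = (2 : ℝ) := Real.mul_self_sqrt (by norm_num)
  have h3 : |t| * |t| = t ^ 2 := by rw [abs_mul_abs_self]; ring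
  linear_combination (|t| * |t| * √x * √y) * h2 + 2 * √x * √y * h3

theorem sign_mul_mul_sqrt_sq {t x σ : ℝ} (hσ : σ ^ 2 = 1) (hx : 0 ≤ x) :
    (σ * (|t| * √(2 * x))) ^ 2 = 2 * t ^ 2 * x := by
  rw [mul_pow, mul_pow, sq_abs, Real.sq_sqrt (by positivity), hσ]; ring

/-- The squares of the chosen constants reproduce the diagonal by linear algebra; the products of
two roots reproduce the off-diagonal entries by the conditions on `f`, `l`, `h`, `i`. -/
theorem ricciTable_of_conditions {M : Matrix (Fin 5) (Fin 5) ℝ} {σ τ t : ℝ}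
    (h : Conditions M σ τ) (i j : Fin 5) :
    ricciTable (|t| * √(2 * coefE M)) (τ * (|t| * √(2 * coefD M))) (|t| * √(2 * coefC M))
      (σ * (|t| * √(2 * coefB M))) (|t| * √(2 * coefA M)) i j = t ^ 2 * M i j := by
  obtain ⟨hσ, hτ, ⟨a, b, c, d, e, f, l, h', i', hM⟩, hA, hB, hC, hD, hE, hf, hl, hh, hi⟩ := h
  have hσ2 : σ ^ 2 = 1 := by rcases hσ with rfl | rfl <;> norm_num
  have hτ2 : τ ^ 2 = 1 := by rcases hτ with rfl | rfl <;> norm_num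
  have one2 : (1 : ℝ) ^ 2 = 1 := one_pow 2
  have qA := sign_mul_mul_sqrt_sq (t := t) one2 hA.le
  have qB := sign_mul_mul_sqrt_sq (t := t) hσ2 hB
  have qC := sign_mul_mul_sqrt_sq (t := t) one2 hC.le
  have qD := sign_mul_mul_sqrt_sq (t := t) hτ2 hD
  have qE := sign_mul_mul_sqrt_sq (t := t) one2 hE.le
  rw [one_mul] at qA qC qE
  have pAB := mul_sqrt_mul_mul_sqrt (t := t) (y := coefB M) hA.le
  have pCD := mul_sqrt_mul_mul_sqrt (t := t) (y := coefD M) hC.le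
  have pDE := mul_sqrt_mul_mul_sqrt (t := t) (y := coefE M) hD
  have pBC := mul_sqrt_mul_mul_sqrt (t := t) (y := coefC M) hB
  have e00 : M 0 0 = a := by simp [hM]
  have e11 : M 1 1 = b := by simp [hM]
  have e22 : M 2 2 = c := by simp [hM]
  have e33 : M 3 3 = d := by simp [hM]
  have e44 : M 4 4 = e := by simp [hM]
  have e01 : M 0 1 = f := by simp [hM]
  have e12 : M 1 2 = l := by simp [hM]
  have e23 : M 2 3 = h' := by simp [hM]
  have e34 : M 3 4 = i' := by simp [hM]
  have vA : coefA M = -(b + c + d + e) := by rw [coefA, e11, e22, e33, e44]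
  have vB : coefB M = b + c + d + 2 * e := by rw [coefB, e11, e22, e33, e44]
  have vC : coefC M = -(a + b + 2 * c + 2 * d + 3 * e) := by
    rw [coefC, e00, e11, e22, e33, e44]
  have vD : coefD M = a + b + 2 * c + 3 * d + 3 * e := by
    rw [coefD, e00, e11, e22, e33, e44]
  have vE : coefE M = -(a + b + c + 2 * d + 2 * e) := by
    rw [coefE, e00, e11, e22, e33, e44]
  rw [e01] at hf
  rw [e12] at hl
  rw [e23] at hh
  rw [e34] at hi
  -- The diagonal entries are inserted on the right-hand sides only, so the square roots on the left
  -- stay untouched.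
  have qA' := qA.trans (congrArg (2 * t ^ 2 * ·) vA)
  have qB' := qB.trans (congrArg (2 * t ^ 2 * ·) vB)
  have qC' := qC.trans (congrArg (2 * t ^ 2 * ·) vC)
  have qD' := qD.trans (congrArg (2 * t ^ 2 * ·) vD)
  have qE' := qE.trans (congrArg (2 * t ^ 2 * ·) vE)
  clear qA qB qC qD qE vA vB vC vD vE e00 e11 e22 e33 e44 e01 e12 e23 e34 hA hB hC hD hE
  -- Only squares and products of the roots matter now; with the roots as free variables the rest is
  -- polynomial algebra.
  generalize |t| * √(2 * coefA M) = A at *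
  generalize |t| * √(2 * coefB M) = B at *
  generalize |t| * √(2 * coefC M) = C at *
  generalize |t| * √(2 * coefD M) = D at *
  generalize |t| * √(2 * coefE M) = E at *
  generalize √(coefA M * coefB M) = rAB at *
  generalize √(coefC M * coefD M) = rCD at *
  generalize √(coefD M * coefE M) = rDE at *
  generalize √(coefB M * coefC M) = rBC at *
  subst hM
  have fE : -(σ * B * A) / 2 = t ^ 2 * f := by
    linear_combination -σ / 2 * pAB - t ^ 2 * hf
  have lE : -(τ * D * C) / 2 = t ^ 2 * l := by
    linear_combination -τ / 2 * pCD - t ^ 2 * hl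
  have hE : E * (τ * D) / 2 = t ^ 2 * h' := by
    linear_combination τ / 2 * pDE + t ^ 2 * hh
  have iE : C * (σ * B) / 2 = t ^ 2 * i' := by
    linear_combination σ / 2 * pBC + t ^ 2 * hi
  fin_cases i <;> fin_cases j <;>
    simp only [ricciTable, Matrix.of_apply, Matrix.cons_val, Fin.zero_eta, Fin.mk_one,
      Fin.reduceFinMk, mul_zero, fE, lE, hE, iE, qA', qB', qC', qD', qE'] <;> ring

/-! ### Left-invariant tensor fields and their values at the identity -/

section LeftInvariant

variable {G : Type*} [TopologicalSpace G] [ChartedSpace R5 G] [Group G]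

/-- All tangent spaces are `R5` by definition, so the same vectors can be used at both points;
needed because `x⁻¹ * x` equals `1` only propositionally. -/
theorem PrescribedRicci.LeftInvSymTensor.val_of_eq_one (T : LeftInvSymTensor G) {y : G}
    (hy : y = 1) (u v : R5) : T.val y u v = T.val 1 u v := by
  subst hy; rfl

theorem PrescribedRicci.LeftInvSymTensor.val_toIdentity (T : LeftInvSymTensor G) (x : G)
    (u v : Tan x) : T.val 1 (toIdentity x u) (toIdentity x v) = T.val x u v := by
  rw [← T.leftInv x⁻¹ x u v]
  exact (T.val_of_eq_one (inv_mul_cancel x) _ _).symm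

theorem toIdentity_one (u : LieAlg G) : toIdentity (1 : G) u = u := by
  have : (fun z : G => (1 : G)⁻¹ * z) = id := by ext; simp
  rw [toIdentity, this, mfderiv_id]
  rfl

/-- `toIdentity` as a linear map. -/
noncomputable def toIdentityLinear (x : G) : Tan x →ₗ[ℝ] LieAlg G :=
  (mfderiv 𝓘(ℝ, R5) 𝓘(ℝ, R5) (fun z : G => x⁻¹ * z) x).toLinearMap

theorem toIdentityLinear_apply (x : G) (u : Tan x) : toIdentityLinear x u = toIdentity x u := rfl

variable [LieGroup 𝓘(ℝ, R5) (minSmoothness ℝ 3) G]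

theorem mdifferentiableAt_leftTranslation (x y : G) :
    MDifferentiableAt 𝓘(ℝ, R5) 𝓘(ℝ, R5) (fun z : G => x * z) y :=
  (contMDiff_mul_left (n := minSmoothness ℝ 3)).contMDiffAt.mdifferentiableAt
    (lt_of_lt_of_le (by simp) le_minSmoothness |>.ne')

theorem toIdentity_mfderiv_mul_left (x y : G) (u : Tan y) :
    toIdentity (x * y) (mfderiv 𝓘(ℝ, R5) 𝓘(ℝ, R5) (fun z : G => x * z) y u) =
      toIdentity y u := by
  have hc : (fun z : G => y⁻¹ * z) = (fun z : G => (x * y)⁻¹ * z) ∘ (fun z : G => x * z) := by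
    ext z; simp only [Function.comp_apply]; group
  simp only [toIdentity]
  rw [hc, mfderiv_comp (I' := 𝓘(ℝ, R5)) y (mdifferentiableAt_leftTranslation _ _)
    (mdifferentiableAt_leftTranslation _ _)]
  rfl

/-- By the chain rule the differential of translation by `x` is a left inverse. This carries
positive definiteness from the identity to every point. -/
theorem toIdentity_injective (x : G) (u : Tan x) (hu : toIdentity x u = 0) : u = 0 := by
  have hc : (fun z : G => x * z) ∘ (fun z : G => x⁻¹ * z) = id := by ext z; simp
  have h := mfderiv_comp (I' := 𝓘(ℝ, R5)) x (mdifferentiableAt_leftTranslation x (x⁻¹ * x))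
    (mdifferentiableAt_leftTranslation x⁻¹ x)
  rw [hc, mfderiv_id] at h
  have h' := congrArg (fun φ => φ u) h
  refine h'.trans ?_
  exact (congrArg (mfderiv 𝓘(ℝ, R5) 𝓘(ℝ, R5) (fun z : G => x * z) (x⁻¹ * x)) hu).trans
    (map_zero _)

/-- The left-invariant tensor field with a given value at the identity. -/
noncomputable def leftInvTensor (b : LinearMap.BilinForm ℝ (LieAlg G))
    (hb : ∀ u v, b u v = b v u) : LeftInvSymTensor G where
  val x := b.compl₁₂ (toIdentityLinear x) (toIdentityLinear x)
  symm x u v := hb _ _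
  leftInv x y u v := by
    simp only [LinearMap.compl₁₂_apply, toIdentityLinear_apply, toIdentity_mfderiv_mul_left]

theorem leftInvTensor_val_one (b : LinearMap.BilinForm ℝ (LieAlg G))
    (hb : ∀ u v, b u v = b v u) (u v : LieAlg G) : (leftInvTensor b hb).val 1 u v = b u v := by
  simp only [leftInvTensor, LinearMap.compl₁₂_apply, toIdentityLinear_apply, toIdentity_one]

/-- The left-invariant metric with a given value at the identity. -/
noncomputable def leftInvMetric (g : InnerProd (LieAlg G)) : LeftInvMetric G where
  toLeftInvSymTensor := leftInvTensor g.form g.symm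
  pos x u hu := g.pos _ fun h => hu (toIdentity_injective x u h)

theorem leftInvMetric_inner (g : InnerProd (LieAlg G)) : (leftInvMetric g).inner.form = g.form :=
  LinearMap.ext fun u => LinearMap.ext fun v => leftInvTensor_val_one g.form g.symm u v

/-- Both sides are left-invariant, so the equation of fields reduces to one on the Lie algebra. -/
theorem ricciEq_iff_one (g : LeftInvMetric G) (t : ℝ) (T : LeftInvSymTensor G) :
    RicciEq g t T ↔ ∀ u v : LieAlg G, ricci g.inner u v = t ^ 2 * T.val 1 u v := by
  refine ⟨fun h u v => ?_, fun h x u v => ?_⟩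
  · have := h 1 u v
    rwa [LeftInvMetric.Ric, toIdentity_one, toIdentity_one] at this
  · rw [LeftInvMetric.Ric, h, T.val_toIdentity]

end LeftInvariant

/-! ### Bilinear forms determined on a basis -/

section Bilinear

variable {L : Type*} [LieRing L] [LieAlgebra ℝ L] [FiniteDimensional ℝ L]

/-- The Ricci curvature as a bilinear form. -/
noncomputable def ricciForm (g : InnerProd L) : LinearMap.BilinForm ℝ L :=
  LinearMap.mk₂ ℝ (ricci g)
    (fun y y' z => by
      rw [ricci, ricci, ricci, ← map_add]; congr 1; ext x; simp [curvatureEnd]; abel)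
    (fun c y z => by
      rw [ricci, ricci, ← map_smul]; congr 1; ext x; simp [curvatureEnd, smul_sub])
    (fun y z z' => by
      rw [ricci, ricci, ricci, ← map_add]; congr 1; ext x; simp [curvatureEnd]; abel)
    (fun c y z => by
      rw [ricci, ricci, ← map_smul]; congr 1; ext x; simp [curvatureEnd, smul_sub])

theorem ricci_eq_iff_basis {ι : Type*} (g : InnerProd L) (v : Module.Basis ι ℝ L)
    (b : LinearMap.BilinForm ℝ L) (s : ℝ) :
    (∀ x y, ricci g x y = s * b x y) ↔ ∀ i j, ricci g (v i) (v j) = s * b (v i) (v j) := by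
  refine ⟨fun h i j => h _ _, fun h x y => ?_⟩
  have : ricciForm g = s • b := LinearMap.BilinForm.ext_basis v fun i j => h i j
  exact congrArg (fun B : LinearMap.BilinForm ℝ L => B x y) this

/-- The inner product for which a given basis is orthonormal. -/
noncomputable def innerOfBasis {V ι : Type*} [AddCommGroup V] [Module ℝ V] [Fintype ι]
    (v : Module.Basis ι ℝ V) : InnerProd V where
  form := LinearMap.mk₂ ℝ (fun x y => ∑ i, v.repr x i * v.repr y i)
    (fun x x' y => by simp [add_mul, Finset.sum_add_distrib])
    (fun c x y => by simp [mul_assoc, Finset.mul_sum])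
    (fun x y y' => by simp [mul_add, Finset.sum_add_distrib])
    (fun c x y => by simp [mul_left_comm, Finset.mul_sum])
  symm x y := by simp [mul_comm]
  pos x hx := by
    simp only [LinearMap.mk₂_apply]
    refine lt_of_le_of_ne (Finset.sum_nonneg fun i _ => mul_self_nonneg _) fun h => hx ?_
    have := (Finset.sum_eq_zero_iff_of_nonneg fun i _ => mul_self_nonneg (v.repr x i)).1 h.symm
    refine v.repr.injective (Finsupp.ext fun i => ?_)
    simpa using this i (Finset.mem_univ i)

theorem innerOfBasis_apply {V ι : Type*} [AddCommGroup V] [Module ℝ V] [Fintype ι]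
    [DecidableEq ι] (v : Module.Basis ι ℝ V) (i j : ι) :
    (innerOfBasis v).form (v i) (v j) = if i = j then 1 else 0 := by
  simp [innerOfBasis, Finsupp.single_apply]

end Bilinear

/-! ### Gram–Schmidt orthonormalisation -/

section GramSchmidt

variable {V : Type*} [AddCommGroup V] [Module ℝ V]

/-- One Gram–Schmidt step. The functional `φ` certifies that `x` lies outside the span of `w`, so
the projected vector is non-zero and can be normalised. -/
theorem PrescribedRicci.InnerProd.exists_unit_orthogonal (g : InnerProd V) {ι : Type*} [Fintype ι]
    [DecidableEq ι] (w : ι → V) (hw : ∀ i j, g.form (w i) (w j) = if i = j then 1 else 0)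
    (x : V) (φ : V →ₗ[ℝ] ℝ) (hx : φ x ≠ 0) (hφ : ∀ i, φ (w i) = 0) :
    ∃ (u : V) (l : ℝ) (a : ι → ℝ), 0 < l ∧ u = l • x + ∑ i, a i • w i ∧ g.form u u = 1 ∧
      ∀ i, g.form u (w i) = 0 := by
  set y : V := x - ∑ i, g.form x (w i) • w i with hy
  have hy0 : y ≠ 0 := fun h => hx <| by
    have := congrArg φ h
    simpa [hy, hφ] using this
  have hyw : ∀ j, g.form y (w j) = 0 := fun j => by
    simp [hy, hw]
  have hpos := g.pos y hy0
  refine ⟨(√(g.form y y))⁻¹ • y, (√(g.form y y))⁻¹,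
    fun i => -((√(g.form y y))⁻¹ * g.form x (w i)), by positivity, ?_, ?_, fun i => ?_⟩
  · simp only [neg_smul, Finset.sum_neg_distrib, mul_smul, ← Finset.smul_sum, ← sub_eq_add_neg,
      ← smul_sub, ← hy]
  · simp only [map_smul, LinearMap.smul_apply, smul_eq_mul]
    rw [← mul_assoc, ← mul_inv, Real.mul_self_sqrt hpos.le, inv_mul_cancel₀ hpos.ne']
  · simp [hyw]

theorem PrescribedRicci.InnerProd.exists_basis_of_orthonormal (g : InnerProd V) {ι : Type*}
    [Fintype ι] [DecidableEq ι] (e : Module.Basis ι ℝ V) (n : ι → V)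
    (hn : ∀ i j, g.form (n i) (n j) = if i = j then 1 else 0) :
    ∃ v : Module.Basis ι ℝ V, ⇑v = n := by
  have hli : LinearIndependent ℝ n := by
    rw [Fintype.linearIndependent_iff]
    intro c hc j
    have := congrArg (fun x => g.form x (n j)) hc
    simpa [hn] using this
  rcases isEmpty_or_nonempty ι with h | h
  · exact ⟨e, funext fun i => h.elim i⟩
  exact ⟨basisOfLinearIndependentOfCardEqFinrank hli
    (Module.finrank_eq_card_basis e).symm, by simp⟩

end GramSchmidt

/-! ### Existence of bases `𝓑₇` and of bases with given constants -/

section Adapted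

variable {L : Type*} [LieRing L] [LieAlgebra ℝ L]

/-- An orthonormal family adapted to the derived series and the centre of `A_{5,3}`. -/
structure Adapted (g : InnerProd L) (n : Fin 5 → L) (p q r s t u w : ℝ) : Prop where
  p_ne : p ≠ 0
  det_ne : s * w - t * u ≠ 0
  orthonormal : ∀ i j, g.form (n i) (n j) = if i = j then 1 else 0
  b12 : ⁅n 0, n 1⁆ = p • n 2 + q • n 3 + r • n 4
  b13 : ⁅n 0, n 2⁆ = s • n 3 + t • n 4
  b23 : ⁅n 1, n 2⁆ = u • n 3 + w • n 4
  b4 : ∀ x : L, ⁅x, n 3⁆ = 0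
  b5 : ∀ x : L, ⁅x, n 4⁆ = 0

theorem PrescribedRicci.HasBrackets.central {v : Module.Basis (Fin 5) ℝ L} {α β γ δ ε : ℝ}
    (h : HasBrackets v α β γ δ ε) (x : L) : ⁅x, v 3⁆ = 0 ∧ ⁅x, v 4⁆ = 0 := by
  have h43 : ⁅v 4, v 3⁆ = 0 := by rw [← lie_skew, h.b45, neg_zero]
  rw [← v.sum_repr x, Fin.sum_univ_five]
  simp only [add_lie, smul_lie, lie_self, smul_zero, add_zero, and_self, h.b14, h.b15, h.b24, h.b25, h.b34, h.b35, h.b45, h43]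

/-- Gram–Schmidt runs from `e 4` down to `e 0`. The span of the last `k` vectors is thus preserved
for every `k`, so the brackets keep their triangular shape. -/
theorem exists_adapted (hL : IsA53 L) (g : InnerProd L) :
    ∃ n p q r s t u w, Adapted g n p q r s t u w := by
  obtain ⟨e, he⟩ := hL
  obtain ⟨n4, l4, a4, hl4, h4, n44, -⟩ := g.exists_unit_orthogonal (![] : Fin 0 → L)
    (fun i => i.elim0) (e 4) (e.coord 4) (by simp) (fun i => i.elim0)
  have h4' : n4 = l4 • e 4 := by simpa using h4
  -- The vanishing of lower coordinates is what lets `e.coord` serve as the certificate `φ` in the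
  -- later steps.
  have r4 : ∀ i, i < 4 → e.repr n4 i = 0 := fun i hi => by
    simp [h4', hi.ne']
  obtain ⟨n3, l3, a3, hl3, h3, n33, n3_⟩ := g.exists_unit_orthogonal ![n4]
    (by simp [Fin.forall_fin_succ, n44]) (e 3) (e.coord 3) (by simp)
    (by simp [r4])
  have h3' : n3 = l3 • e 3 + a3 0 • n4 := by simpa using h3
  have n34 : g.form n3 n4 = 0 := by simpa using n3_ 0
  have n43 : g.form n4 n3 = 0 := by rw [g.symm, n34]
  have r3 : ∀ i, i < 3 → e.repr n3 i = 0 := fun i hi => by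
    simp [h3', hi.ne', r4 i (hi.trans (by decide))]
  obtain ⟨n2, l2, a2, hl2, h2, n22, n2_⟩ := g.exists_unit_orthogonal ![n3, n4]
    (by simp [Fin.forall_fin_succ, n44, n33, n34, n43]) (e 2) (e.coord 2) (by simp)
    (by simp [Fin.forall_fin_succ, r4, r3])
  have h2' : n2 = l2 • e 2 + (a2 0 • n3 + a2 1 • n4) := by simpa using h2
  have n23 : g.form n2 n3 = 0 := by simpa using n2_ 0
  have n24 : g.form n2 n4 = 0 := by simpa using n2_ 1
  have n32 : g.form n3 n2 = 0 := by rw [g.symm, n23]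
  have n42 : g.form n4 n2 = 0 := by rw [g.symm, n24]
  have r2 : ∀ i, i < 2 → e.repr n2 i = 0 := fun i hi => by
    simp [h2', hi.ne', r4 i (hi.trans (by decide)), r3 i (hi.trans (by decide))]
  obtain ⟨n1, l1, a1, hl1, h1, n11, n1_⟩ := g.exists_unit_orthogonal ![n2, n3, n4]
    (by simp [Fin.forall_fin_succ, n44, n33, n34, n43, n22, n23, n24, n32, n42])
    (e 1) (e.coord 1) (by simp) (by simp [Fin.forall_fin_succ, r4, r3, r2])
  have h1' : n1 = l1 • e 1 + (a1 0 • n2 + a1 1 • n3 + a1 2 • n4) := by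
    simpa [Fin.sum_univ_three] using h1
  have n12 : g.form n1 n2 = 0 := by simpa using n1_ 0
  have n13 : g.form n1 n3 = 0 := by simpa using n1_ 1
  have n14 : g.form n1 n4 = 0 := by simpa using n1_ 2
  have n21 : g.form n2 n1 = 0 := by rw [g.symm, n12]
  have n31 : g.form n3 n1 = 0 := by rw [g.symm, n13]
  have n41 : g.form n4 n1 = 0 := by rw [g.symm, n14]
  have r1 : ∀ i, i < 1 → e.repr n1 i = 0 := fun i hi => by
    simp [h1', hi.ne', r4 i (hi.trans (by decide)), r3 i (hi.trans (by decide)),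
      r2 i (hi.trans (by decide))]
  obtain ⟨n0, l0, a0, hl0, h0, n00, n0_⟩ := g.exists_unit_orthogonal ![n1, n2, n3, n4]
    (by simp [Fin.forall_fin_succ, n44, n33, n34, n43, n22, n23, n24, n32, n42, n11, n12, n13,
      n14, n21, n31, n41])
    (e 0) (e.coord 0) (by simp) (by simp [Fin.forall_fin_succ, r4, r3, r2, r1])
  have h0' : n0 = l0 • e 0 + (a0 0 • n1 + a0 1 • n2 + a0 2 • n3 + a0 3 • n4) := by
    simpa [Fin.sum_univ_four] using h0
  have n01 : g.form n0 n1 = 0 := by simpa using n0_ 0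
  have n02 : g.form n0 n2 = 0 := by simpa using n0_ 1
  have n03 : g.form n0 n3 = 0 := by simpa using n0_ 2
  have n04 : g.form n0 n4 = 0 := by simpa using n0_ 3
  have n10 : g.form n1 n0 = 0 := by rw [g.symm, n01]
  have n20 : g.form n2 n0 = 0 := by rw [g.symm, n02]
  have n30 : g.form n3 n0 = 0 := by rw [g.symm, n03]
  have n40 : g.form n4 n0 = 0 := by rw [g.symm, n04]
  have z4 : ∀ x : L, ⁅x, n4⁆ = 0 := fun x => by rw [h4', lie_smul, (he.central x).2, smul_zero]
  have z3 : ∀ x : L, ⁅x, n3⁆ = 0 := fun x => by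
    rw [h3', lie_add, lie_smul, lie_smul, (he.central x).1, z4, smul_zero, smul_zero, add_zero]
  have z4' : ∀ x : L, ⁅n4, x⁆ = 0 := fun x => by rw [← lie_skew, z4, neg_zero]
  have z3' : ∀ x : L, ⁅n3, x⁆ = 0 := fun x => by rw [← lie_skew, z3, neg_zero]
  -- The triangular change of basis is inverted, to express the brackets of the `e i` in the new
  -- vectors.
  have e4 : e 4 = l4⁻¹ • n4 := by rw [h4', inv_smul_smul₀ hl4.ne']
  have e3 : e 3 = l3⁻¹ • (n3 - a3 0 • n4) := by
    rw [h3', add_sub_cancel_right, inv_smul_smul₀ hl3.ne']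
  have e2 : e 2 = l2⁻¹ • (n2 - (a2 0 • n3 + a2 1 • n4)) := by
    rw [h2', add_sub_cancel_right, inv_smul_smul₀ hl2.ne']
  have be12 : ⁅e 1, n2⁆ = (l2 * l4⁻¹) • n4 := by
    rw [h2', lie_add, lie_add, lie_smul, lie_smul, lie_smul, z3, z4, he.b23, e4]; module
  have be02 : ⁅e 0, n2⁆ = (l2 * l3⁻¹) • n3 - (l2 * l3⁻¹ * a3 0) • n4 := by
    rw [h2', lie_add, lie_add, lie_smul, lie_smul, lie_smul, z3, z4, he.b13, e3]; module
  have b12 : ⁅n1, n2⁆ = (l1 * (l2 * l4⁻¹)) • n4 := by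
    rw [h1', add_lie, add_lie, add_lie, smul_lie, smul_lie, smul_lie, smul_lie, z3', z4',
      lie_self, be12]; module
  have b02 : ⁅n0, n2⁆ = (l0 * (l2 * l3⁻¹)) • n3 +
      (a0 0 * (l1 * (l2 * l4⁻¹)) - l0 * (l2 * l3⁻¹ * a3 0)) • n4 := by
    rw [h0', add_lie, add_lie, add_lie, add_lie, smul_lie, smul_lie, smul_lie, smul_lie,
      smul_lie, z3', z4', lie_self, be02, b12]; module
  have be01 : ⁅e 0, n1⁆ = (l1 * l2⁻¹) • n2 + (a1 0 * (l2 * l3⁻¹) - l1 * l2⁻¹ * a2 0) • n3 +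
      (-(a1 0 * (l2 * l3⁻¹ * a3 0)) - l1 * l2⁻¹ * a2 1) • n4 := by
    rw [h1', lie_add, lie_add, lie_add, lie_smul, lie_smul, lie_smul, lie_smul, z3, z4, be02,
      he.b12, e2]; module
  have b21 : ⁅n2, n1⁆ = -(l1 * (l2 * l4⁻¹)) • n4 := by rw [← lie_skew, b12, neg_smul]
  refine ⟨![n0, n1, n2, n3, n4], l0 * (l1 * l2⁻¹), l0 * (a1 0 * (l2 * l3⁻¹) - l1 * l2⁻¹ * a2 0),
    l0 * (-(a1 0 * (l2 * l3⁻¹ * a3 0)) - l1 * l2⁻¹ * a2 1) - a0 1 * (l1 * (l2 * l4⁻¹)),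
    l0 * (l2 * l3⁻¹), a0 0 * (l1 * (l2 * l4⁻¹)) - l0 * (l2 * l3⁻¹ * a3 0), 0,
    l1 * (l2 * l4⁻¹), by positivity, ?_, ?_, ?_, b02, ?_, z3, z4⟩
  · rw [mul_zero, sub_zero]; positivity
  · intro i j
    fin_cases i <;> fin_cases j <;>
      simp [n00, n01, n02, n03, n04, n10, n11, n12, n13, n14, n20, n21, n22, n23, n24,
        n30, n31, n32, n33, n34, n40, n41, n42, n43, n44]
  · change ⁅n0, n1⁆ = _ • n2 + _ • n3 + _ • n4
    rw [h0', add_lie, add_lie, add_lie, add_lie, smul_lie, smul_lie, smul_lie, smul_lie,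
      smul_lie, z3', z4', lie_self, be01, b21]; module
  · change ⁅n1, n2⁆ = _ • n3 + _ • n4
    rw [b12, zero_smul, zero_add]

theorem exists_unit_parallel (q r : ℝ) : ∃ c d : ℝ, c ^ 2 + d ^ 2 = 1 ∧ q * d = r * c := by
  rcases eq_or_ne (q ^ 2 + r ^ 2) 0 with h | h
  · have hq : q = 0 := by nlinarith [sq_nonneg q, sq_nonneg r]
    have hr : r = 0 := by nlinarith [sq_nonneg q, sq_nonneg r]
    exact ⟨1, 0, by norm_num, by rw [hq, hr]; ring⟩
  · have hp : 0 < q ^ 2 + r ^ 2 := lt_of_le_of_ne (by positivity) h.symm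
    refine ⟨q / √(q ^ 2 + r ^ 2), r / √(q ^ 2 + r ^ 2), ?_, by ring⟩
    rw [div_pow, div_pow, Real.sq_sqrt hp.le, ← add_div, div_self h]

/-- A rotation in the centre. -/
theorem Adapted.rotate_centre {g : InnerProd L} {n : Fin 5 → L} {p q r s t u w : ℝ}
    (h : Adapted g n p q r s t u w) : ∃ n' q' s' t' u' w', Adapted g n' p q' 0 s' t' u' w' := by
  -- The new fourth vector points along `q • n 3 + r • n 4`, which removes the fifth component of
  -- the bracket of the first two vectors.
  obtain ⟨c, d, hcd, hqr⟩ := exists_unit_parallel q r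
  refine ⟨![n 0, n 1, n 2, c • n 3 + d • n 4, -d • n 3 + c • n 4], q * c + r * d, s * c + t * d,
    -s * d + t * c, u * c + w * d, -u * d + w * c, h.p_ne, ?_, ?_, ?_, ?_, ?_, fun x => ?_,
    fun x => ?_⟩
  · have := h.det_ne
    contrapose! this
    linear_combination this - (s * w - t * u) * hcd
  · intro i j
    fin_cases i <;> fin_cases j <;> simp [h.orthonormal] <;>
      first | ring1 | linear_combination hcd
  · change ⁅n 0, n 1⁆ = _ • n 2 + _ • (c • n 3 + d • n 4) + _ • (-d • n 3 + c • n 4)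
    rw [h.b12]
    match_scalars
    · ring
    · linear_combination -q * hcd + d * hqr
    · linear_combination -r * hcd - c * hqr
  · change ⁅n 0, n 2⁆ = _ • (c • n 3 + d • n 4) + _ • (-d • n 3 + c • n 4)
    rw [h.b13]
    match_scalars
    · linear_combination -s * hcd
    · linear_combination -t * hcd
  · change ⁅n 1, n 2⁆ = _ • (c • n 3 + d • n 4) + _ • (-d • n 3 + c • n 4)
    rw [h.b23]
    match_scalars
    · linear_combination -u * hcd
    · linear_combination -w * hcd
  · change ⁅x, c • n 3 + d • n 4⁆ = 0
    simp [h.b4, h.b5]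
  · change ⁅x, -d • n 3 + c • n 4⁆ = 0
    simp [h.b4, h.b5]

/-- A rotation of the first two vectors. -/
theorem Adapted.rotate_generators {g : InnerProd L} {n : Fin 5 → L} {p q r s t u w : ℝ}
    (h : Adapted g n p q r s t u w) : ∃ n' s' t' w', Adapted g n' p q r s' t' 0 w' := by
  -- With `(a, b)` parallel to `(s, u)`, the combination `-b * s + a * u` vanishes. A rotation has
  -- determinant 1, so the bracket of the first two vectors is unchanged.
  obtain ⟨a, b, hab, hsu⟩ := exists_unit_parallel s u
  have b10 : ⁅n 1, n 0⁆ = -(p • n 2 + q • n 3 + r • n 4) := by rw [← lie_skew, h.b12]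
  refine ⟨![a • n 0 + b • n 1, -b • n 0 + a • n 1, n 2, n 3, n 4], a * s + b * u, a * t + b * w,
    -b * t + a * w, h.p_ne, ?_, ?_, ?_, ?_, ?_, h.b4, h.b5⟩
  · have := h.det_ne
    contrapose! this
    linear_combination this - (s * w - t * u) * hab + (a * t + b * w) * hsu
  · intro i j
    fin_cases i <;> fin_cases j <;> simp [h.orthonormal] <;>
      first | ring1 | linear_combination hab
  · change ⁅a • n 0 + b • n 1, -b • n 0 + a • n 1⁆ = p • n 2 + q • n 3 + r • n 4
    simp only [add_lie, lie_add, smul_lie, lie_smul, lie_self, h.b12, b10]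
    match_scalars
    · linear_combination p * hab
    · linear_combination q * hab
    · linear_combination r * hab
  · change ⁅a • n 0 + b • n 1, n 2⁆ = _ • n 3 + _ • n 4
    simp only [add_lie, smul_lie, h.b13, h.b23]
    module
  · change ⁅-b • n 0 + a • n 1, n 2⁆ = _ • n 3 + _ • n 4
    simp only [add_lie, smul_lie, h.b13, h.b23]
    match_scalars
    · linear_combination -hsu
    · ring

theorem exists_sq_eq_one_mul_pos {x : ℝ} (hx : x ≠ 0) : ∃ σ : ℝ, σ ^ 2 = 1 ∧ 0 < σ * x := by
  rcases hx.lt_or_gt with h | h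
  · exact ⟨-1, by norm_num, by linarith⟩
  · exact ⟨1, by norm_num, by linarith⟩

/-- Every inner product on `A_{5,3}` has a basis `𝓑₇`. -/
theorem exists_isB7 (hL : IsA53 L) (g : InnerProd L) :
    ∃ (v : Module.Basis (Fin 5) ℝ L) (α β γ δ ε : ℝ), IsB7 g v α β γ δ ε := by
  obtain ⟨n₁, p, q₁, r, s₁, t₁, u₁, w₁, h₁⟩ := exists_adapted hL g
  -- The order matters: rotating the centre may produce a non-zero `u`, whereas rotating the
  -- generators afterwards preserves `r = 0`.
  obtain ⟨n₂, q, s₂, t₂, u₂, w₂, h₂⟩ := h₁.rotate_centre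
  obtain ⟨n, s, t, w, h⟩ := h₂.rotate_generators
  have hsw : s * w ≠ 0 := by simpa using h.det_ne
  -- The sign `x` of the third vector makes `α` positive; `y` and `z` then absorb it to make `γ` and
  -- `ε` positive.
  obtain ⟨x, hx, hxp⟩ := exists_sq_eq_one_mul_pos h.p_ne
  have hx0 : x ≠ 0 := by rintro rfl; simp at hx
  obtain ⟨y, hy, hys⟩ := exists_sq_eq_one_mul_pos (mul_ne_zero hx0 (left_ne_zero_of_mul hsw))
  obtain ⟨z, hz, hzw⟩ := exists_sq_eq_one_mul_pos (mul_ne_zero hx0 (right_ne_zero_of_mul hsw))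
  obtain ⟨e, -⟩ := hL
  have hon : ∀ i j, g.form ((![n 0, n 1, x • n 2, y • n 3, z • n 4] : Fin 5 → L) i)
      ((![n 0, n 1, x • n 2, y • n 3, z • n 4] : Fin 5 → L) j) = if i = j then 1 else 0 := by
    intro i j
    fin_cases i <;> fin_cases j <;> simp [h.orthonormal] <;> linarith
  obtain ⟨v, hv⟩ := g.exists_basis_of_orthonormal e _ hon
  refine ⟨v, x * p, y * q, y * (x * s), z * (x * t), z * (x * w), hxp, hys, hzw, ?_, 1, one_pos,
    fun i j => by rw [one_mul, hv]; exact hon i j⟩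
  have v0 : v 0 = n 0 := by rw [hv]; rfl
  have v1 : v 1 = n 1 := by rw [hv]; rfl
  have v2 : v 2 = x • n 2 := by rw [hv]; rfl
  have v3 : v 3 = y • n 3 := by rw [hv]; rfl
  have v4 : v 4 = z • n 4 := by rw [hv]; rfl
  constructor
  · rw [v0, v1, v2, v3, h.b12]
    match_scalars
    · linear_combination -p * hx
    · linear_combination -q * hy
    · ring
  · rw [v0, v2, v3, v4, lie_smul, h.b13]
    match_scalars
    · linear_combination -x * s * hy
    · linear_combination -x * t * hz
  · rw [v1, v2, v4, lie_smul, h.b23]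
    match_scalars
    · ring
    · linear_combination -x * w * hz
  all_goals simp only [v3, v4, lie_smul, h.b4, h.b5, smul_zero]

/-- `A_{5,3}` has bases with arbitrary structure constants `α, γ, ε > 0` and `β, δ`. -/
theorem exists_hasBrackets (hL : IsA53 L) {α γ ε : ℝ} (hα : 0 < α) (hγ : 0 < γ) (hε : 0 < ε)
    (β δ : ℝ) : ∃ v : Module.Basis (Fin 5) ℝ L, HasBrackets v α β γ δ ε := by
  obtain ⟨e, he⟩ := hL
  -- Keeping `e 0` and `e 1`, the required brackets read `e 2 = α • u2 + β • u3`, `e 3 = α • (γ • u3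
  -- + δ • u4)`, `e 4 = (α * ε) • u4`; they are solved from the last one upwards.
  obtain ⟨u4, hu4⟩ : ∃ u : L, u = (α * ε)⁻¹ • e 4 := ⟨_, rfl⟩
  obtain ⟨u3, hu3⟩ : ∃ u : L, u = γ⁻¹ • (α⁻¹ • e 3 - δ • u4) := ⟨_, rfl⟩
  obtain ⟨u2, hu2⟩ : ∃ u : L, u = α⁻¹ • (e 2 - β • u3) := ⟨_, rfl⟩
  have e4 : e 4 = (α * ε) • u4 := by rw [hu4, smul_inv_smul₀ (by positivity)]
  have e3 : e 3 = α • (γ • u3 + δ • u4) := by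
    rw [hu3, smul_inv_smul₀ hγ.ne', sub_add_cancel, smul_inv_smul₀ hα.ne']
  have e2 : e 2 = α • u2 + β • u3 := by rw [hu2, smul_inv_smul₀ hα.ne', sub_add_cancel]
  have hspan : ⊤ ≤ Submodule.span ℝ (Set.range ![e 0, e 1, u2, u3, u4]) := by
    rw [← e.span_eq, Submodule.span_le]
    have m : ∀ i, (![e 0, e 1, u2, u3, u4] : Fin 5 → L) i ∈
        Submodule.span ℝ (Set.range ![e 0, e 1, u2, u3, u4]) :=
      fun i => Submodule.subset_span ⟨i, rfl⟩
    have m2 := m 2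
    have m3 := m 3
    have m4 := m 4
    rintro _ ⟨i, rfl⟩
    fin_cases i
    · exact m 0
    · exact m 1
    · change e 2 ∈ _
      rw [e2]
      exact add_mem (Submodule.smul_mem _ _ m2) (Submodule.smul_mem _ _ m3)
    · change e 3 ∈ _
      rw [e3]
      exact Submodule.smul_mem _ _
        (add_mem (Submodule.smul_mem _ _ m3) (Submodule.smul_mem _ _ m4))
    · change e 4 ∈ _
      rw [e4]
      exact Submodule.smul_mem _ _ m4
  have hli := linearIndependent_of_top_le_span_of_card_eq_finrank hspan
    (Module.finrank_eq_card_basis e).symm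
  have z4 : ∀ x : L, ⁅x, u4⁆ = 0 := fun x => by rw [hu4, lie_smul, (he.central x).2, smul_zero]
  have z3 : ∀ x : L, ⁅x, u3⁆ = 0 := fun x => by
    rw [hu3, lie_smul, lie_sub, lie_smul, lie_smul, (he.central x).1, z4]; simp
  refine ⟨Module.Basis.mk hli hspan, ?_⟩
  constructor <;> simp only [Module.Basis.mk_apply, Matrix.cons_val, z3, z4]
  · rw [he.b12, one_smul, zero_smul, add_zero, e2]
  · rw [hu2, lie_smul, lie_sub, lie_smul, z3, he.b13, one_smul, zero_smul, add_zero, smul_zero,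
      sub_zero, e3, inv_smul_smul₀ hα.ne']
  · rw [hu2, lie_smul, lie_sub, lie_smul, z3, he.b23, one_smul, smul_zero,
      sub_zero, e4, mul_smul, inv_smul_smul₀ hα.ne']

end Adapted

/-! ### Solutions of the prescribed Ricci equation -/

section Solutions

variable {G : Type*} [TopologicalSpace G] [ChartedSpace R5 G] [Group G]
  [LieGroup 𝓘(ℝ, R5) (minSmoothness ℝ 3) G]

theorem ricciEq_iff_ricciTable {g : LeftInvMetric G} {T : LeftInvSymTensor G}
    {v : Module.Basis (Fin 5) ℝ (LieAlg G)} {α β γ δ ε : ℝ} (h : IsB7 g.inner v α β γ δ ε)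
    (t : ℝ) :
    RicciEq g t T ↔ ∀ i j, ricciTable α β γ δ ε i j = t ^ 2 * T.matrix v i j := by
  rw [ricciEq_iff_one, ricci_eq_iff_basis g.inner v (T.val 1)]
  simp only [h.ricci_eq]
  rfl

theorem isB7_leftInvMetric {v : Module.Basis (Fin 5) ℝ (LieAlg G)} {α β γ δ ε : ℝ}
    (h : HasBrackets v α β γ δ ε) (hα : 0 < α) (hγ : 0 < γ) (hε : 0 < ε) :
    IsB7 (leftInvMetric (innerOfBasis v)).inner v α β γ δ ε := by
  refine ⟨hα, hγ, hε, h, 1, one_pos, fun i j => ?_⟩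
  rw [leftInvMetric_inner, one_mul, innerOfBasis_apply]

theorem PrescribedRicci.Conditions.symm_apply {M : Matrix (Fin 5) (Fin 5) ℝ} {σ τ : ℝ}
    (h : Conditions M σ τ) (i j : Fin 5) : M i j = M j i := by
  obtain ⟨a, b, c, d, e, f, l, h, k, rfl⟩ := h.form
  fin_cases i <;> fin_cases j <;> rfl

/-- The left-invariant tensor field with a given symmetric matrix in a basis. -/
theorem exists_tensor_matrix_eq (v : Module.Basis (Fin 5) ℝ (LieAlg G))
    {M : Matrix (Fin 5) (Fin 5) ℝ} (hM : ∀ i j, M i j = M j i) :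
    ∃ T : LeftInvSymTensor G, T.matrix v = M := by
  have happ : ∀ i j, Matrix.toBilin v M (v i) (v j) = M i j := fun i j => by
    rw [← LinearMap.BilinForm.toMatrix_apply v, LinearMap.BilinForm.toMatrix_toBilin]
  have hsymm : ∀ x y, Matrix.toBilin v M x y = Matrix.toBilin v M y x := fun x y => by
    have : Matrix.toBilin v M = LinearMap.flip (Matrix.toBilin v M) :=
      LinearMap.BilinForm.ext_basis v fun i j => by
        rw [LinearMap.flip_apply, happ, happ, hM]
    exact congrArg (fun B : LinearMap.BilinForm ℝ (LieAlg G) => B x y) this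
  refine ⟨leftInvTensor (Matrix.toBilin v M) hsymm, ?_⟩
  ext i j
  exact (leftInvTensor_val_one _ hsymm _ _).trans (happ i j)

theorem abs_mul_sqrt_two_mul_pos {t x : ℝ} (ht : t ≠ 0) (hx : 0 < x) : 0 < |t| * √(2 * x) := by
  positivity

theorem exists_solution_of_conditions (hG : IsA53 (LieAlg G)) {M : Matrix (Fin 5) (Fin 5) ℝ}
    {σ τ : ℝ} (h : Conditions M σ τ) {t : ℝ} (ht : t ≠ 0) :
    ∃ (g : LeftInvMetric G) (T : LeftInvSymTensor G)
      (v : Module.Basis (Fin 5) ℝ (LieAlg G)) (α β γ δ ε : ℝ),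
      IsB7 g.inner v α β γ δ ε ∧ T.matrix v = M ∧ RicciEq g t T := by
  have hα := abs_mul_sqrt_two_mul_pos ht h.E_pos
  have hγ := abs_mul_sqrt_two_mul_pos ht h.C_pos
  have hε := abs_mul_sqrt_two_mul_pos ht h.A_pos
  obtain ⟨v, hv⟩ := exists_hasBrackets hG hα hγ hε (τ * (|t| * √(2 * coefD M)))
    (σ * (|t| * √(2 * coefB M)))
  obtain ⟨T, hT⟩ := exists_tensor_matrix_eq v h.symm_apply
  have hB7 := isB7_leftInvMetric hv hα hγ hε
  refine ⟨_, T, v, _, _, _, _, _, hB7, hT, ?_⟩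
  rw [ricciEq_iff_ricciTable hB7, hT]
  exact ricciTable_of_conditions h

theorem conditions_of_ricciEq {g : LeftInvMetric G} {T : LeftInvSymTensor G} {t : ℝ}
    (ht : t ≠ 0) (h : RicciEq g t T) {v : Module.Basis (Fin 5) ℝ (LieAlg G)} {α β γ δ ε : ℝ}
    (hv : IsB7 g.inner v α β γ δ ε) :
    ∃ σ τ : ℝ, Conditions (T.matrix v) σ τ ∧
      α = |t| * √(2 * coefE (T.matrix v)) ∧ β = τ * (|t| * √(2 * coefD (T.matrix v))) ∧
      γ = |t| * √(2 * coefC (T.matrix v)) ∧ δ = σ * (|t| * √(2 * coefB (T.matrix v))) ∧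
      ε = |t| * √(2 * coefA (T.matrix v)) :=
  conditions_of_ricciTable ht hv.α_pos hv.γ_pos hv.ε_pos ((ricciEq_iff_ricciTable hv t).1 h)

end Solutions

theorem mainTheorem5
    {G : Type*} [TopologicalSpace G] [ChartedSpace R5 G] [Group G]
    [LieGroup 𝓘(ℝ, R5) (minSmoothness ℝ 3) G]
    (hG : IsA53 (LieAlg G)) :
    -- every left-invariant metric has a basis `𝓑₇`
    (∀ g : LeftInvMetric G, ∃ (v : Module.Basis (Fin 5) ℝ (LieAlg G)) (α β γ δ ε : ℝ),
      IsB7 g.inner v α β γ δ ε) ∧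
    -- if `(g, t)` solves the equation for `T`, the conditions hold in every basis `𝓑₇` for `g`
    (∀ (T : LeftInvSymTensor G) (g : LeftInvMetric G) (t : ℝ), t ≠ 0 → RicciEq g t T →
      ∀ (v : Module.Basis (Fin 5) ℝ (LieAlg G)) (α β γ δ ε : ℝ), IsB7 g.inner v α β γ δ ε →
        ∃ σ τ : ℝ, Conditions (T.matrix v) σ τ) ∧
    -- the equation is solvable for the matrix `M` in a basis `𝓑₇` for the unknown metric if and
    -- only if `M` satisfies the conditions
    (∀ M : Matrix (Fin 5) (Fin 5) ℝ,
      (∃ (g : LeftInvMetric G) (t : ℝ) (T : LeftInvSymTensor G)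
          (v : Module.Basis (Fin 5) ℝ (LieAlg G)) (α β γ δ ε : ℝ),
          t ≠ 0 ∧ IsB7 g.inner v α β γ δ ε ∧ T.matrix v = M ∧ RicciEq g t T) ↔
        ∃ σ τ : ℝ, Conditions M σ τ) ∧
    -- in that case the constant `t ≠ 0` can be prescribed
    (∀ (M : Matrix (Fin 5) (Fin 5) ℝ) (σ τ : ℝ), Conditions M σ τ → ∀ t : ℝ, t ≠ 0 →
      ∃ (g : LeftInvMetric G) (T : LeftInvSymTensor G)
        (v : Module.Basis (Fin 5) ℝ (LieAlg G)) (α β γ δ ε : ℝ),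
        IsB7 g.inner v α β γ δ ε ∧ T.matrix v = M ∧ RicciEq g t T) ∧
    -- for a given tensor field `T`
    (∀ T : LeftInvSymTensor G,
      (∃ (g : LeftInvMetric G) (t : ℝ), t ≠ 0 ∧ RicciEq g t T) ↔
        ∃ (t : ℝ) (v : Module.Basis (Fin 5) ℝ (LieAlg G)) (σ τ : ℝ),
          t ≠ 0 ∧ Conditions (T.matrix v) σ τ ∧
          HasBrackets v
            (|t| * √(2 * coefE (T.matrix v))) (τ * (|t| * √(2 * coefD (T.matrix v))))
            (|t| * √(2 * coefC (T.matrix v))) (σ * (|t| * √(2 * coefB (T.matrix v))))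
            (|t| * √(2 * coefA (T.matrix v)))) := by
  refine ⟨fun g => exists_isB7 hG g.inner, ?_, fun M => ⟨?_, ?_⟩, ?_, fun T => ⟨?_, ?_⟩⟩
  · intro T g t ht h v α β γ δ ε hv
    obtain ⟨σ, τ, hc, -⟩ := conditions_of_ricciEq ht h hv
    exact ⟨σ, τ, hc⟩
  · rintro ⟨g, t, T, v, α, β, γ, δ, ε, ht, hv, rfl, h⟩
    obtain ⟨σ, τ, hc, -⟩ := conditions_of_ricciEq ht h hv
    exact ⟨σ, τ, hc⟩
  · rintro ⟨σ, τ, hc⟩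
    obtain ⟨g, T, v, α, β, γ, δ, ε, hv, hT, h⟩ :=
      -- Any non-zero `t` would do.
      exists_solution_of_conditions hG hc one_ne_zero
    exact ⟨g, 1, T, v, α, β, γ, δ, ε, one_ne_zero, hv, hT, h⟩
  · intro M σ τ hc t ht
    exact exists_solution_of_conditions hG hc ht
  · rintro ⟨g, t, ht, h⟩
    obtain ⟨v, α, β, γ, δ, ε, hv⟩ := exists_isB7 hG g.inner
    obtain ⟨σ, τ, hc, rfl, rfl, rfl, rfl, rfl⟩ := conditions_of_ricciEq ht h hv
    exact ⟨t, v, σ, τ, ht, hc, hv.brackets⟩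
  · rintro ⟨t, v, σ, τ, ht, hc, hv⟩
    -- The metric is the one for which `v` is orthonormal.
    have hB7 := isB7_leftInvMetric hv (abs_mul_sqrt_two_mul_pos ht hc.E_pos)
      (abs_mul_sqrt_two_mul_pos ht hc.C_pos) (abs_mul_sqrt_two_mul_pos ht hc.A_pos)
    exact ⟨_, t, ht, (ricciEq_iff_ricciTable hB7 t).2 (ricciTable_of_conditions hc)⟩
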